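/- Let $S$ be a compact Hausdorff space without isolated points, let $C(S)$ be the Banach space of continuous functions $S\to\mathbb{C}$ with the supremum norm $\|\cdot\|_\infty$, let $u\in C(S)$ with $u\not\equiv 0$, and let $\varphi:S\to S$ be continuous. Let $uC_\varphi:C(S)\to C(S)$ be the weighted composition operator $uC_\varphi(f)=u\cdot(f\circ\varphi)$. Then the equation $$\|uC_\varphi+T\|=\|u\|_\infty+\|T\|$$ holds for every weakly compact bounded linear operator $T:C(S)\to C(S)$ if and only if $|u|$ is constant on $S$ and $\varphi^{-1}(\{t\})$ is nowhere dense in $S$ for every $t\in S$. Moreover, for the necessity rank-$1$ operators suffice: if the equation holds for every bounded linear operator $T:C(S)\to C(S)$ of rank $1$, then $|u|$ is constant on $S$ and $\varphi^{-1}(\{t\})$ is nowhere dense in $S$ for every $t\in S$. -/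

import Mathlib

/-- The weighted composition operator `u C_φ : f ↦ u · (f ∘ φ)` on the Banach space `C(S, ℂ)`
of continuous complex functions with the supremum norm. -/
noncomputable def weightedComp {S : Type*} [TopologicalSpace S] [CompactSpace S]
    (u : C(S, ℂ)) (φ : C(S, S)) : C(S, ℂ) →L[ℂ] C(S, ℂ) where
  toFun f := u * f.comp φ
  map_add' f g := by ext s; simp [mul_add]
  map_smul' c f := by ext s; simp
  cont := by fun_prop

theorem weightedComp_apply {S : Type*} [TopologicalSpace S] [CompactSpace S]
    (u : C(S, ℂ)) (φ : C(S, S)) (f : C(S, ℂ)) (s : S) :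
    weightedComp u φ f s = u s * f (φ s) := rfl

/-- A bounded linear operator is weakly compact if the image of the closed unit ball is
relatively compact for the weak topology of the target space. -/
def IsWeaklyCompactOperator {E F : Type*} [NormedAddCommGroup E] [NormedSpace ℂ E]
    [NormedAddCommGroup F] [NormedSpace ℂ F] (T : E →L[ℂ] F) : Prop :=
  IsCompact (closure (toWeakSpace ℂ F '' (T '' Metric.closedBall (0 : E) 1)))

/-- The bounded operators whose range is one-dimensional. -/
def IsRankOneOperator {E F : Type*} [NormedAddCommGroup E] [NormedSpace ℂ E]
    [NormedAddCommGroup F] [NormedSpace ℂ F] (T : E →L[ℂ] F) : Prop :=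
  (T : E →ₗ[ℂ] F).rank = 1

/-- The norm equation `‖u C_φ + T‖ = ‖u‖_∞ + ‖T‖`. -/
def SatisfiesNormEquation {S : Type*} [TopologicalSpace S] [CompactSpace S]
    (u : C(S, ℂ)) (φ : C(S, S)) (T : C(S, ℂ) →L[ℂ] C(S, ℂ)) : Prop :=
  ‖weightedComp u φ + T‖ = ‖u‖ + ‖T‖

/-!
*Sufficiency.* Write `μ_s` for the functional `f ↦ T f s`, thought of as a complex measure. The atom
`μ_s {t}` can be read off from peak functions: if `h` takes values in `[0, 1]`, equals `1` at `t` and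
is supported in a small neighbourhood of `t`, then `T h s` is close to `μ_s {t}`. No measure is
needed: a weakly compact `T` maps an ultrafilter of peak functions shrinking to `t` to a weakly
convergent one, and the limit `g t` is a *continuous* function of `s` (`IsAtomFunction`,
`IsWeaklyCompactOperator.exists_isAtomFunction`). Peak functions at distinct points with disjoint
supports give `∑ t ∈ A, ‖g t s‖ ≤ ‖T‖` (`sum_norm_atomFunction_le`).

If the fibres of `φ` are nowhere dense, then every nonempty open set contains a point `s` at which
the atom of `μ_s` at `φ s` is small (`exists_norm_atomFunction_comp_lt`). Otherwise all these atoms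
are at least `ε` on an open set; a point `s` where finitely many of the `g t` are large can be moved,
by continuity and avoiding the corresponding fibres, to a point `s'` where in addition
`g (φ s')` is large. This produces arbitrarily many atoms of size `ε / 2`, against the bound
`‖T‖`. At a point `s` where the atom is small, a function almost attaining `‖T‖` at `s` may be
given any unimodular value at `φ s` at almost no cost in `T f s` (`exists_prescribed_value`), so
that `u s * f (φ s)` and `T f s` have the same phase and their moduli add up.

*Necessity.* The operators `f ↦ f t • h` have rank one and are weakly compact. If `‖u s‖` is below
its maximum on an open set, a bump `h` supported there violates the equation; if a fibre of `φ` over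
`t` has interior, a bump times `-u` supported there does.
-/

open Topology Filter

/-! ### Unimodular factors and weak convergence -/

theorem exists_unimodular_mul_eq_norm (z : ℂ) : ∃ c : ℂ, ‖c‖ = 1 ∧ c * z = ‖z‖ := by
  refine ⟨Complex.exp ((-z.arg : ℝ) * Complex.I), Complex.norm_exp_ofReal_mul_I _, ?_⟩
  conv_lhs => rw [← Complex.norm_mul_exp_arg_mul_I z]
  rw [mul_left_comm, ← Complex.exp_add]
  simp

theorem exists_unimodular_norm_mul_add (a z : ℂ) :
    ∃ ω : ℂ, ‖ω‖ = 1 ∧ ‖a * ω + z‖ = ‖a‖ + ‖z‖ := by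
  obtain ⟨c, hc, hca⟩ := exists_unimodular_mul_eq_norm a
  obtain ⟨d, hd, hdz⟩ := exists_unimodular_mul_eq_norm z
  have hd0 : d ≠ 0 := by rintro rfl; simp at hd
  refine ⟨c / d, by simp [hc, hd], ?_⟩
  have : d * (a * (c / d) + z) = ((‖a‖ + ‖z‖ : ℝ) : ℂ) := by
    push_cast
    rw [← hca, ← hdz]
    field_simp
  have h2 := congrArg norm this
  rwa [norm_mul, hd, one_mul, Complex.norm_real, Real.norm_of_nonneg (by positivity)] at h2

theorem tendsto_eval_of_tendsto_weakSpace {S ι : Type*} [TopologicalSpace S]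
    {l : Filter ι} {f : ι → C(S, ℂ)}
    {g : WeakSpace ℂ C(S, ℂ)} (hf : Tendsto (fun i => toWeakSpace ℂ C(S, ℂ) (f i)) l (𝓝 g)) (s : S) :
    Tendsto (fun i => f i s) l (𝓝 ((toWeakSpace ℂ C(S, ℂ)).symm g s)) :=
  ((WeakBilin.eval_continuous (topDualPairing ℂ C(S, ℂ)).flip
    (ContinuousMap.evalCLM ℂ s)).tendsto g).comp hf

/-! ### Peak functions -/

/-- `h` takes values in `[0, 1]`, equals `1` at `t` and vanishes off `V`. The condition on the values
is encoded, inside the complex numbers, by `h x = ‖h x‖` and `‖h x‖ ≤ 1`. -/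
structure IsPeakFunction {S : Type*} [TopologicalSpace S] (t : S) (V : Set S) (h : C(S, ℂ)) :
    Prop where
  coe_norm : ∀ x, (‖h x‖ : ℂ) = h x
  norm_le_one : ∀ x, ‖h x‖ ≤ 1
  apply_self : h t = 1
  eq_zero : ∀ x, x ∉ V → h x = 0

section

variable {S : Type*} [TopologicalSpace S]

theorem IsPeakFunction.mono {t : S} {V W : Set S} {h : C(S, ℂ)} (hh : IsPeakFunction t V h)
    (hVW : V ⊆ W) : IsPeakFunction t W h :=
  ⟨hh.coe_norm, hh.norm_le_one, hh.apply_self, fun x hx => hh.eq_zero x fun hV => hx (hVW hV)⟩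

theorem IsPeakFunction.ne_zero {t : S} {V : Set S} {h : C(S, ℂ)} (hh : IsPeakFunction t V h) :
    h ≠ 0 := by
  rintro rfl
  simpa using hh.apply_self

variable [CompactSpace S]

theorem IsPeakFunction.norm_le {t : S} {V : Set S} {h : C(S, ℂ)} (hh : IsPeakFunction t V h) :
    ‖h‖ ≤ 1 :=
  (ContinuousMap.norm_le _ zero_le_one).2 hh.norm_le_one

theorem exists_isPeakFunction [T2Space S] {t : S} {V : Set S} (hV : V ∈ 𝓝 t) :
    ∃ h : C(S, ℂ), IsPeakFunction t V h := by
  obtain ⟨U, hUV, hU, htU⟩ := mem_nhds_iff.1 hV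
  obtain ⟨χ, h0, h1, h01⟩ := exists_continuous_zero_one_of_isClosed hU.isClosed_compl
    (isClosed_singleton (x := t)) (by simpa using htU)
  have hn : ∀ x, ‖(χ x : ℂ)‖ = χ x := fun x => by
    rw [Complex.norm_real, Real.norm_of_nonneg (h01 x).1]
  refine ⟨⟨fun x => (χ x : ℂ), by fun_prop⟩, fun x => ?_, fun x => ?_, ?_, fun x hx => ?_⟩
  · exact congrArg Complex.ofReal (hn x)
  · exact (hn x).trans_le (h01 x).2
  · simpa using h1 (Set.mem_singleton t)
  · simpa using h0 (fun hxU => hx (hUV hxU))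

/-! ### Atom functions of weakly compact operators -/

/-- `g s` is a limit point of `T h s` along peak functions `h` whose supports shrink to `t`. In terms
of the measures `μ_s` representing `f ↦ T f s`, this says `g s = μ_s {t}`. -/
def IsAtomFunction (T : C(S, ℂ) →L[ℂ] C(S, ℂ)) (t : S) (g : C(S, ℂ)) : Prop :=
  ∀ s : S, ∀ V ∈ 𝓝 t, ∀ ε > 0, ∃ h, IsPeakFunction t V h ∧ ‖T h s - g s‖ < ε

/-- This replaces the bidual argument, by which a weakly compact operator has its second adjoint
map the characteristic function of `{t}` into `C(S, ℂ)`. -/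
theorem IsWeaklyCompactOperator.exists_isAtomFunction [T2Space S] {T : C(S, ℂ) →L[ℂ] C(S, ℂ)}
    (hT : IsWeaklyCompactOperator T) (t : S) : ∃ g, IsAtomFunction T t g := by
  let F : Filter C(S, ℂ) := (𝓝 t).lift' fun V => {h | IsPeakFunction t V h}
  have hmono : Monotone fun V : Set S => {h : C(S, ℂ) | IsPeakFunction t V h} :=
    fun V W hVW h hh => IsPeakFunction.mono hh hVW
  have : F.NeBot := (lift'_neBot_iff hmono).2 fun V hV => exists_isPeakFunction hV
  have hmem : ∀ V ∈ 𝓝 t, ∀ᶠ h in (Ultrafilter.of F : Filter C(S, ℂ)), IsPeakFunction t V h :=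
    fun V hV => Ultrafilter.of_le F (mem_lift' hV)
  obtain ⟨g, -, hg⟩ := hT.ultrafilter_le_nhds
    ((Ultrafilter.of F).map fun h => toWeakSpace ℂ C(S, ℂ) (T h)) (by
      rw [le_principal_iff, Ultrafilter.coe_map, mem_map]
      filter_upwards [hmem Set.univ univ_mem] with h hh
      exact subset_closure ⟨T h, ⟨h, by simpa using hh.norm_le, rfl⟩, rfl⟩)
  refine ⟨(toWeakSpace ℂ C(S, ℂ)).symm g, fun s V hV ε hε => ?_⟩
  have hlim := tendsto_eval_of_tendsto_weakSpace (f := fun h => T h) hg s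
  obtain ⟨h, h1, h2⟩ := ((hmem V hV).and (hlim (Metric.ball_mem_nhds _ hε))).exists
  exact ⟨h, h1, by simpa [dist_eq_norm] using h2⟩

/-- The total mass of the atoms of a measure is at most its variation. -/
theorem sum_norm_atomFunction_le [T2Space S] {T : C(S, ℂ) →L[ℂ] C(S, ℂ)} {g : S → C(S, ℂ)}
    (hg : ∀ t, IsAtomFunction T t (g t)) (A : Finset S) (s : S) :
    ∑ t ∈ A, ‖g t s‖ ≤ ‖T‖ := by
  refine le_of_forall_pos_le_add fun ε hε => ?_
  obtain ⟨V, hV, hdisj⟩ := A.finite_toSet.t2_separation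
  let δ := ε / (A.card + 1)
  have hδ : 0 < δ := by positivity
  choose h hpeak hclose using fun t => hg t s (V t) ((hV t).2.mem_nhds (hV t).1) δ hδ
  choose c hc hcg using fun t => exists_unimodular_mul_eq_norm (g t s)
  -- The supports are disjoint, so at most one term of the sum survives at each point.
  have hnorm : ‖∑ t ∈ A, c t • h t‖ ≤ 1 := by
    refine (ContinuousMap.norm_le _ zero_le_one).2 fun x => ?_
    rw [ContinuousMap.sum_apply]
    by_cases hx : ∃ t ∈ A, x ∈ V t
    · obtain ⟨t, ht, hxt⟩ := hx
      rw [Finset.sum_eq_single_of_mem t ht]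
      · simpa [hc] using (hpeak t).norm_le_one x
      · intro b hb hbt
        have : x ∉ V b := fun hxb =>
          Set.disjoint_left.1 (hdisj (Finset.mem_coe.2 hb) (Finset.mem_coe.2 ht) hbt) hxb hxt
        simp [(hpeak b).eq_zero x this]
    · push Not at hx
      rw [Finset.sum_eq_zero]
      · simp
      · intro b hb
        simp [(hpeak b).eq_zero x (hx b hb)]
  have hTle : ‖T (∑ t ∈ A, c t • h t) s‖ ≤ ‖T‖ :=
    (ContinuousMap.norm_coe_le_norm _ s).trans (T.unit_le_opNorm _ hnorm)
  have hdiff : ‖∑ t ∈ A, c t * g t s - T (∑ t ∈ A, c t • h t) s‖ ≤ ε := by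
    rw [map_sum, ContinuousMap.sum_apply, ← Finset.sum_sub_distrib]
    refine (norm_sum_le_of_le A (f := fun t => c t * g t s - T (c t • h t) s)
      (n := fun _ => δ) fun t _ => ?_).trans ?_
    · rw [map_smul, ContinuousMap.smul_apply, smul_eq_mul, ← mul_sub, norm_mul, hc, one_mul,
        norm_sub_rev]
      exact (hclose t).le
    · rw [Finset.sum_const, nsmul_eq_mul, mul_div_assoc', div_le_iff₀ (by positivity)]
      nlinarith
  have hsum : ‖∑ t ∈ A, c t * g t s‖ = ∑ t ∈ A, ‖g t s‖ := by
    simp_rw [hcg]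
    rw [← Complex.ofReal_sum, Complex.norm_real, Real.norm_of_nonneg (by positivity)]
  calc ∑ t ∈ A, ‖g t s‖ = ‖∑ t ∈ A, c t * g t s‖ := hsum.symm
    _ ≤ ‖T (∑ t ∈ A, c t • h t) s‖ + ‖∑ t ∈ A, c t * g t s - T (∑ t ∈ A, c t • h t) s‖ :=
        norm_le_norm_add_norm_sub' _ _
    _ ≤ ‖T‖ + ε := add_le_add hTle hdiff

theorem exists_norm_atomFunction_comp_lt [T2Space S] {T : C(S, ℂ) →L[ℂ] C(S, ℂ)}
    {g : S → C(S, ℂ)} (hg : ∀ t, IsAtomFunction T t (g t)) {φ : C(S, S)}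
    (hφ : ∀ t, IsNowhereDense (φ ⁻¹' {t})) {U : Set S} (hU : IsOpen U) (hne : U.Nonempty)
    {ε : ℝ} (hε : 0 < ε) : ∃ s ∈ U, ‖g (φ s) s‖ < ε := by
  by_contra! hlarge
  have key : ∀ n : ℕ, ∃ A : Finset S, A.card = n ∧ ∃ s ∈ U, ∀ t ∈ A, ε / 2 < ‖g t s‖ := by
    classical
    intro n
    induction n with
    | zero => exact ⟨∅, rfl, hne.some, hne.some_mem, by simp⟩
    | succ n ih =>
      obtain ⟨A, hA, s, hs, hsA⟩ := ih
      have hW : IsOpen (U ∩ ⋂ t ∈ A, {x | ε / 2 < ‖g t x‖}) :=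
        hU.inter (isOpen_biInter_finset fun t _ => isOpen_lt continuous_const (by fun_prop))
      have hclosed : ∀ t, IsClosed (φ ⁻¹' {t}) := fun t => isClosed_singleton.preimage φ.continuous
      have hdense : Dense (⋂ t ∈ (A : Set S), (φ ⁻¹' {t})ᶜ) :=
        dense_biInter_of_isOpen (fun t _ => (hclosed t).isOpen_compl) A.countable_toSet
          fun t _ => (isClosed_isNowhereDense_iff_compl.1 ⟨hclosed t, hφ t⟩).2
      obtain ⟨x, ⟨hxU, hxA⟩, hxφ⟩ := hdense.inter_open_nonempty _ hW
        ⟨s, hs, by simpa using hsA⟩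
      simp only [Set.mem_iInter, Set.mem_ofPred_eq] at hxA
      have hnot : φ x ∉ A := fun hmem => by
        simp only [Set.mem_iInter] at hxφ
        exact hxφ (φ x) hmem rfl
      refine ⟨insert (φ x) A, by rw [Finset.card_insert_of_notMem hnot, hA], x, hxU, fun t ht => ?_⟩
      obtain rfl | ht := Finset.mem_insert.1 ht
      · linarith [hlarge x hxU]
      · exact hxA t ht
  obtain ⟨n, hn⟩ := exists_nat_gt (‖T‖ / (ε / 2))
  obtain ⟨A, hA, s, -, hsA⟩ := key n
  have h1 : (n : ℝ) * (ε / 2) ≤ ∑ t ∈ A, ‖g t s‖ := by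
    rw [← hA, ← nsmul_eq_mul]
    exact Finset.card_nsmul_le_sum _ _ _ fun t ht => (hsA t ht).le
  rw [div_lt_iff₀ (by positivity)] at hn
  linarith [sum_norm_atomFunction_le hg A s]

/-! ### Sufficiency -/

/-- The value of `f` at `t` can be changed to any `ω` of modulus at most `1`, at the cost of
about twice the modulus of the atom at `t`. -/
theorem exists_prescribed_value {T : C(S, ℂ) →L[ℂ] C(S, ℂ)} {t : S} {g : C(S, ℂ)}
    (hg : IsAtomFunction T t g) (s : S) {f : C(S, ℂ)} (hf : ‖f‖ ≤ 1) {ω : ℂ} (hω : ‖ω‖ ≤ 1)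
    {ε : ℝ} (hε : 0 < ε) :
    ∃ f' : C(S, ℂ), ‖f'‖ ≤ 1 ∧ f' t = ω ∧ ‖T f' s - T f s‖ ≤ 2 * ‖g s‖ + ε := by
  have hf1 : ∀ x, ‖f x‖ ≤ 1 := fun x => (f.norm_coe_le_norm x).trans hf
  let δ := ε / (2 * (‖T‖ + 1))
  have hδ : 0 < δ := by positivity
  have hV : {x | ‖f x - f t‖ < δ} ∈ 𝓝 t :=
    (isOpen_lt (by fun_prop) continuous_const).mem_nhds (by simpa using hδ)
  obtain ⟨h, hh, hclose⟩ := hg s _ hV (ε / 4) (by positivity)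
  -- The error made by freezing `f` at its value `f t` on the support of `h`.
  let e : C(S, ℂ) := f * h - f t • h
  have he : ‖e‖ ≤ δ := by
    refine (ContinuousMap.norm_le _ hδ.le).2 fun x => ?_
    have hex : e x = (f x - f t) * h x := by simp [e, sub_mul]
    rw [hex, norm_mul]
    by_cases hx : ‖f x - f t‖ < δ
    · exact (mul_le_of_le_one_right (norm_nonneg _) (hh.norm_le_one x)).trans hx.le
    · simpa [hh.eq_zero x hx] using hδ.le
  refine ⟨f + ω • h - f * h, ?_, ?_, ?_⟩
  · refine (ContinuousMap.norm_le _ zero_le_one).2 fun x => ?_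
    have hx : (f + ω • h - f * h) x = ((1 - ‖h x‖ : ℝ) : ℂ) * f x + (‖h x‖ : ℂ) * ω := by
      have hx' : (f + ω • h - f * h) x = f x + ω * h x - f x * h x := rfl
      rw [hx']
      push_cast
      rw [hh.coe_norm]
      ring
    have h1 := hh.norm_le_one x
    rw [hx]
    refine (norm_add_le _ _).trans ?_
    rw [norm_mul, norm_mul, Complex.norm_real, Complex.norm_real, norm_norm,
      Real.norm_of_nonneg (by linarith)]
    nlinarith [hf1 x, norm_nonneg (h x)]
  · simp [hh.apply_self]
  · have hdecomp : f + ω • h - f * h = f + (ω • h - f t • h - e) := by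
      simp only [e]
      abel
    have hTe : ‖T e s‖ ≤ ε / 2 := by
      refine ((T e).norm_coe_le_norm s).trans ((T.le_opNorm_of_le he).trans ?_)
      rw [mul_div_assoc', div_le_div_iff₀ (by positivity) (by positivity)]
      nlinarith
    have hTh : ‖T h s‖ ≤ ‖g s‖ + ε / 4 := by
      linarith [norm_le_norm_add_norm_sub' (T h s) (g s)]
    have hval : T (f + ω • h - f * h) s - T f s = ω * T h s - f t * T h s - T e s := by
      rw [hdecomp]
      simp
    rw [hval]
    have h1 := norm_sub_le (ω * T h s - f t * T h s) (T e s)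
    have h2 := norm_sub_le (ω * T h s) (f t * T h s)
    rw [norm_mul, norm_mul] at h2
    have h3 := mul_le_of_le_one_left (norm_nonneg (T h s)) hω
    have h4 := mul_le_of_le_one_left (norm_nonneg (T h s)) (hf1 t)
    linarith

theorem norm_weightedComp_le (u : C(S, ℂ)) (φ : C(S, S)) : ‖weightedComp u φ‖ ≤ ‖u‖ := by
  refine ContinuousLinearMap.opNorm_le_bound _ (norm_nonneg _) fun f => ?_
  refine (ContinuousMap.norm_le _ (by positivity)).2 fun s => ?_
  rw [weightedComp_apply, norm_mul]
  exact mul_le_mul (u.norm_coe_le_norm s) (f.norm_coe_le_norm _) (norm_nonneg _) (norm_nonneg _)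

theorem satisfiesNormEquation_of_isWeaklyCompactOperator [T2Space S] [Nonempty S] {u : C(S, ℂ)}
    {φ : C(S, S)} {c : ℝ} (hc : ∀ s, ‖u s‖ = c) (hφ : ∀ t, IsNowhereDense (φ ⁻¹' {t}))
    {T : C(S, ℂ) →L[ℂ] C(S, ℂ)} (hT : IsWeaklyCompactOperator T) :
    SatisfiesNormEquation u φ T := by
  refine le_antisymm ((norm_add_le _ _).trans (by gcongr; exact norm_weightedComp_le u φ)) ?_
  have huc : ‖u‖ ≤ c := (ContinuousMap.norm_le_of_nonempty _).2 fun s => (hc s).le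
  choose g hg using fun t => hT.exists_isAtomFunction t
  refine le_of_forall_pos_le_add fun ε hε => ?_
  obtain ⟨f, hf, hTf⟩ := T.exists_lt_apply_of_lt_opNorm (sub_lt_self ‖T‖ (by positivity : 0 < ε / 4))
  have hne : {s | ‖T‖ - ε / 4 < ‖T f s‖}.Nonempty := by
    by_contra hempty
    refine hTf.not_ge ((ContinuousMap.norm_le_of_nonempty _).2 fun s => ?_)
    exact not_lt.1 fun hs => hempty ⟨s, hs⟩
  obtain ⟨s, hs, hgs⟩ := exists_norm_atomFunction_comp_lt hg hφ
    (isOpen_lt continuous_const (by fun_prop)) hne (by positivity : 0 < ε / 4)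
  obtain ⟨ω, hω, hphase⟩ := exists_unimodular_norm_mul_add (u s) (T f s)
  obtain ⟨f', hf', hf'ω, hdiff⟩ :=
    exists_prescribed_value (hg (φ s)) s hf.le hω.le (by positivity : 0 < ε / 4)
  have hle : ‖u s * ω + T f' s‖ ≤ ‖weightedComp u φ + T‖ := by
    have := ((weightedComp u φ + T) f').norm_coe_le_norm s
    rw [add_apply, ContinuousMap.add_apply, weightedComp_apply, hf'ω] at this
    exact this.trans ((weightedComp u φ + T).unit_le_opNorm _ hf')
  have htri : ‖u s * ω + T f s‖ ≤ ‖u s * ω + T f' s‖ + ‖T f' s - T f s‖ := by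
    refine (norm_sub_le (u s * ω + T f' s) (T f' s - T f s)).trans' (le_of_eq ?_)
    congr 1
    ring
  have hs' : ‖T‖ - ε / 4 < ‖T f s‖ := hs
  rw [hphase, hc] at htri
  linarith

/-! ### Necessity -/

theorem isRankOneOperator_smulRight {E F : Type*} [NormedAddCommGroup E] [NormedSpace ℂ E]
    [NormedAddCommGroup F] [NormedSpace ℂ F] {ℓ : E →L[ℂ] ℂ} (hℓ : ℓ ≠ 0) {h : F} (hh : h ≠ 0) :
    IsRankOneOperator (ℓ.smulRight h) := by
  have hr : LinearMap.range ((ℓ.smulRight h : E →L[ℂ] F) : E →ₗ[ℂ] F) = Submodule.span ℂ {h} :=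
    ContinuousLinearMap.range_smulRight_apply hℓ h
  rw [IsRankOneOperator, LinearMap.rank, hr, Module.rank_eq_one_iff_finrank_eq_one]
  exact finrank_span_singleton hh

theorem isWeaklyCompactOperator_smulRight {E F : Type*} [NormedAddCommGroup E] [NormedSpace ℂ E]
    [NormedAddCommGroup F] [NormedSpace ℂ F] (ℓ : E →L[ℂ] ℂ) (h : F) :
    IsWeaklyCompactOperator (ℓ.smulRight h) := by
  have hK : IsCompact ((fun c : ℂ => toWeakSpaceCLM ℂ F (c • h)) '' Metric.closedBall 0 ‖ℓ‖) :=
    (isCompact_closedBall _ _).image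
      ((toWeakSpaceCLM ℂ F).continuous.comp (continuous_id.smul (continuous_const (y := h))))
  refine hK.closure_of_subset ?_
  rintro _ ⟨_, ⟨f, hf, rfl⟩, rfl⟩
  exact ⟨ℓ f, by simpa using ℓ.unit_le_opNorm f (by simpa using hf), rfl⟩

/-- If the equation holds for `T f = f t • h`, any bound `M` on the norm of `u C_φ + T`, given
pointwise, is at least `‖u‖ + ‖h‖`, because `T 1 = h`. The necessity follows by choosing `h` such
that a smaller bound is evident. -/
theorem norm_add_norm_le_of_satisfiesNormEquation {u : C(S, ℂ)} {φ : C(S, S)} {t : S}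
    {h : C(S, ℂ)}
    (heq : SatisfiesNormEquation u φ ((ContinuousMap.evalCLM ℂ t).smulRight h)) {M : ℝ}
    (hM : ∀ f : C(S, ℂ), ∀ s, ‖u s * f (φ s) + f t * h s‖ ≤ M * ‖f‖) : ‖u‖ + ‖h‖ ≤ M := by
  have : Nonempty S := ⟨t⟩
  have hM0 : 0 ≤ M := by simpa using (norm_nonneg _).trans (hM 1 t)
  let T : C(S, ℂ) →L[ℂ] C(S, ℂ) := (ContinuousMap.evalCLM ℂ t : C(S, ℂ) →L[ℂ] ℂ).smulRight h
  have hT1 : T 1 = h := by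
    ext x
    simp [T]
  have h1 : ‖h‖ ≤ ‖T‖ := by
    simpa [hT1] using T.le_opNorm 1
  have h2 : ‖weightedComp u φ + T‖ ≤ M :=
    ContinuousLinearMap.opNorm_le_bound _ hM0 fun f =>
      (ContinuousMap.norm_le _ (by positivity)).2 fun s => hM f s
  have h3 : ‖weightedComp u φ + T‖ = ‖u‖ + ‖T‖ := heq
  linarith

theorem norm_eq_norm_of_satisfiesNormEquation [T2Space S] {u : C(S, ℂ)} {φ : C(S, S)}
    (heq : ∀ (t : S) (h : C(S, ℂ)), h ≠ 0 →
      SatisfiesNormEquation u φ ((ContinuousMap.evalCLM ℂ t).smulRight h)) (s₀ : S) :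
    ‖u s₀‖ = ‖u‖ := by
  refine le_antisymm (u.norm_coe_le_norm s₀) (not_lt.1 fun hlt => ?_)
  obtain ⟨r, hr1, hr2⟩ := exists_between hlt
  obtain ⟨h, hh⟩ := exists_isPeakFunction (t := s₀) (V := {s | ‖u s‖ < r})
    ((isOpen_lt (by fun_prop) continuous_const).mem_nhds hr1)
  have h1 : 1 ≤ ‖h‖ := by simpa [hh.apply_self] using h.norm_coe_le_norm s₀
  have hle : ‖u‖ + ‖h‖ ≤ max (r + 1) ‖u‖ := by
    refine norm_add_norm_le_of_satisfiesNormEquation (heq s₀ h hh.ne_zero) fun f s => ?_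
    have hfφ := f.norm_coe_le_norm (φ s)
    by_cases hs : ‖u s‖ < r
    · calc ‖u s * f (φ s) + f s₀ * h s‖ ≤ ‖u s‖ * ‖f (φ s)‖ + ‖f s₀‖ * ‖h s‖ := by
            simpa only [norm_mul] using norm_add_le (u s * f (φ s)) (f s₀ * h s)
        _ ≤ r * ‖f‖ + ‖f‖ * 1 := by
            gcongr
            · exact (norm_nonneg _).trans hs.le
            · exact f.norm_coe_le_norm s₀
            · exact hh.norm_le_one s
        _ = (r + 1) * ‖f‖ := by ring
        _ ≤ max (r + 1) ‖u‖ * ‖f‖ := by gcongr; exact le_max_left _ _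
    · rw [hh.eq_zero s hs, mul_zero, add_zero, norm_mul]
      calc ‖u s‖ * ‖f (φ s)‖ ≤ ‖u‖ * ‖f‖ := by
            gcongr
            exact u.norm_coe_le_norm s
        _ ≤ max (r + 1) ‖u‖ * ‖f‖ := by gcongr; exact le_max_right _ _
  rcases max_cases (r + 1) ‖u‖ with h2 | h2 <;> linarith

theorem isNowhereDense_fiber_of_satisfiesNormEquation [T2Space S] {u : C(S, ℂ)} (hu : u ≠ 0)
    {φ : C(S, S)} (hc : ∀ s, ‖u s‖ = ‖u‖)
    (heq : ∀ (t : S) (h : C(S, ℂ)), h ≠ 0 →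
      SatisfiesNormEquation u φ ((ContinuousMap.evalCLM ℂ t).smulRight h)) (t : S) :
    IsNowhereDense (φ ⁻¹' {t}) := by
  have hu0 : 0 < ‖u‖ := norm_pos_iff.2 hu
  rw [(isClosed_singleton.preimage φ.continuous).isNowhereDense_iff]
  by_contra hne
  obtain ⟨s₀, hs₀⟩ := Set.nonempty_iff_ne_empty.2 hne
  obtain ⟨h, hh⟩ := exists_isPeakFunction (isOpen_interior.mem_nhds hs₀)
  have hval : ‖(-(u * h)) s₀‖ = ‖u‖ := by simp [hh.apply_self, hc]
  have hne' : -(u * h) ≠ 0 := fun h0 => by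
    rw [h0] at hval
    exact hu0.ne (by simpa using hval)
  have hle : ‖u‖ + ‖-(u * h)‖ ≤ ‖u‖ := by
    refine norm_add_norm_le_of_satisfiesNormEquation (heq t _ hne') fun f s => ?_
    by_cases hs : s ∈ interior (φ ⁻¹' {t})
    · have hφs : φ s = t := by
        have hmem : s ∈ φ ⁻¹' {t} := interior_subset hs
        exact hmem
      have hfac : u s * f (φ s) + f t * (-(u * h)) s = u s * f t * ((1 - ‖h s‖ : ℝ) : ℂ) := by
        push_cast
        rw [hh.coe_norm, hφs, ContinuousMap.neg_apply, ContinuousMap.mul_apply]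
        ring
      have h1 := hh.norm_le_one s
      rw [hfac, norm_mul, norm_mul, Complex.norm_real, Real.norm_of_nonneg (by linarith), hc]
      calc ‖u‖ * ‖f t‖ * (1 - ‖h s‖) ≤ ‖u‖ * ‖f t‖ :=
            mul_le_of_le_one_right (by positivity) (by linarith [norm_nonneg (h s)])
        _ ≤ ‖u‖ * ‖f‖ := by gcongr; exact f.norm_coe_le_norm t
    · simp only [ContinuousMap.neg_apply, ContinuousMap.mul_apply, hh.eq_zero s hs, mul_zero,
        neg_zero, add_zero, norm_mul, hc]
      gcongr
      exact f.norm_coe_le_norm _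
  have h2 := (-(u * h)).norm_coe_le_norm s₀
  linarith

end

theorem theorem1 {S : Type*} [TopologicalSpace S] [CompactSpace S] [T2Space S] [PerfectSpace S]
    (u : C(S, ℂ)) (hu : u ≠ 0) (φ : C(S, S)) :
    ((∀ T : C(S, ℂ) →L[ℂ] C(S, ℂ), IsWeaklyCompactOperator T → SatisfiesNormEquation u φ T) ↔
      ((∃ c : ℝ, ∀ s : S, ‖u s‖ = c) ∧ ∀ t : S, IsNowhereDense (φ ⁻¹' {t}))) ∧
    ((∀ T : C(S, ℂ) →L[ℂ] C(S, ℂ), IsRankOneOperator T → SatisfiesNormEquation u φ T) →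
      ((∃ c : ℝ, ∀ s : S, ‖u s‖ = c) ∧ ∀ t : S, IsNowhereDense (φ ⁻¹' {t}))) := by
  have hS : Nonempty S := by
    obtain ⟨s, -⟩ := DFunLike.ne_iff.1 hu
    exact ⟨s⟩
  have necessity (heq : ∀ (t : S) (h : C(S, ℂ)), h ≠ 0 →
      SatisfiesNormEquation u φ ((ContinuousMap.evalCLM ℂ t).smulRight h)) :
      (∃ c : ℝ, ∀ s : S, ‖u s‖ = c) ∧ ∀ t : S, IsNowhereDense (φ ⁻¹' {t}) := by
    have hc := norm_eq_norm_of_satisfiesNormEquation heq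
    exact ⟨⟨‖u‖, hc⟩, isNowhereDense_fiber_of_satisfiesNormEquation hu hc heq⟩
  refine ⟨⟨fun H => necessity fun t h _ => H _ (isWeaklyCompactOperator_smulRight _ h), ?_⟩,
    fun H => necessity fun t h hh => H _ (isRankOneOperator_smulRight ?_ hh)⟩
  · rintro ⟨⟨c, hc⟩, hφ⟩ T hT
    exact satisfiesNormEquation_of_isWeaklyCompactOperator hc hφ hT
  · intro h0
    simpa using DFunLike.congr_fun h0 (1 : C(S, ℂ))
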